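/- Let $\mathbb{F}_q$ be the finite field with $q$ elements and characteristic $p$, and let $D\subseteq\mathbb{F}_q$ with $|D|=n$. For integers $k,r\ge 0$ and $\gamma\in\mathbb{F}_q$, let $N(x^{k+1}+\gamma x^k,r)$ denote the number of monic polynomials $g\in\mathbb{F}_q[x]$ of degree $k+1$ whose coefficient of $x^k$ is $\gamma$ and which have exactly $r$ distinct roots in $D$. Empty sums are $0$, and $\binom{a}{b}=0$ if $b<0$. **Theorem 3.** Suppose that $0\notin D$ and that $D\cup\{0\}$ is an additive subgroup of $\mathbb{F}_q$. (a) If $\gamma\in D$, then $$N(x^{k+1}+\gamma x^k,r)=q^{k-r}\binom{n}{r}\sum_{j=0}^{k-r}(-q)^{-j}\binom{n-r}{j}+\frac{1}{n+1}(-1)^{k+1-r}\binom{n}{r}\binom{n-r}{k+1-r}-\frac{1}{n+1}(-1)^r\binom{k+1}{r}\sum_{0\le j\le (k+1)/p}(-1)^j\binom{(n+1)/p}{j}.$$ (b) If $\gamma\notin D\cup\{0\}$, then $$N(x^{k+1}+\gamma x^k,r)=q^{k-r}\binom{n}{r}\sum_{j=0}^{k-r}(-q)^{-j}\binom{n-r}{j}.$$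 (c) If $\gamma=0$, then $$N(x^{k+1}+\gamma x^k,r)=q^{k-r}\binom{n}{r}\sum_{j=0}^{k-r}(-q)^{-j}\binom{n-r}{j}+\frac{1}{n+1}(-1)^{k+1-r}\binom{n}{r}\binom{n-r}{k+1-r}+\frac{n}{n+1}(-1)^r\binom{k+1}{r}\sum_{0\le j\le (k+1)/p}(-1)^j\binom{(n+1)/p}{j}.$$ -/

import Mathlib

open Polynomial

/-- The `i`-th leading coefficient `f_i` of `f = x^d + f_1 x^(d-1) + ⋯ + f_d`;
missing coefficients (`i > d`) are read as zero. -/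
def leadingCoeffAt {F : Type*} [Field F] (f : F[X]) (i : ℕ) : F :=
  if i ≤ f.natDegree then f.coeff (f.natDegree - i) else 0

/-- `f` and `g` have the same `ℓ` leading coefficients `f_1, …, f_ℓ`. -/
def SameLeading {F : Type*} [Field F] (ℓ : ℕ) (f g : F[X]) : Prop :=
  ∀ i : ℕ, 1 ≤ i → i ≤ ℓ → leadingCoeffAt g i = leadingCoeffAt f i

/-- The monic polynomials `g` with the degree of `f` and the same `ℓ` leading coefficients as `f`
that have exactly `r` distinct roots in `D`. -/
def prescribedSet {F : Type*} [Field F] (ℓ : ℕ) (D : Finset F) (f : F[X]) (r : ℕ) : Set F[X] :=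
  {g | g.Monic ∧ g.natDegree = f.natDegree ∧ SameLeading ℓ f g ∧
    {x : F | x ∈ D ∧ g.IsRoot x}.ncard = r}

/-- The number `N(f, r)`, for `ℓ` prescribed leading coefficients and the evaluation set `D`.
(The set that is counted is finite when `F` is.) -/
noncomputable def countN {F : Type*} [Field F] (ℓ : ℕ) (D : Finset F) (f : F[X]) (r : ℕ) : ℕ :=
  (prescribedSet ℓ D f r).ncard

/-- Binomial coefficient with an integer lower index; it is `0` when that index is negative. -/
def binom (a : ℕ) (b : ℤ) : ℚ :=
  if 0 ≤ b then (a.choose b.toNat : ℚ) else 0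

/-! ### Subset sums in an elementary abelian group, by characters. -/

section SubsetSums

/-! Inclusion-exclusion over the subsets `S` of `D` on which `g` vanishes. Dividing by `∏ a ∈ S, (X
- C a)` shows that a set of size `s ≤ k` admits `q ^ (k - s)` polynomials, whatever `S` and `γ` are.
Only `s = k + 1` sees `γ`: then `g` is the product itself, and it counts iff `S` sums to `-γ`. So
the count is a universal sum plus a correction (`countN_one_eq`).

To count these `S`, put `H = D ∪ {0}` and use orthogonality of characters. A nontrivial character
takes each `p`-th root of unity `|H| / p` times, so the product of `1 - ψ(x) X` over nonzero `x` is
`(1 - X ^ p) ^ (|H| / p) / (1 - X)` for every such `ψ`. Its coefficients are the alternating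
binomial sums of the theorem. Summing `ψ(γ)` over `ψ ≠ 0` gives `n` or `-1`, which separates (c)
from (a). -/

theorem coeff_one_sub_X_pow {R : Type*} [CommRing R] (n t : ℕ) :
    ((1 - X : R[X]) ^ n).coeff t = (-1) ^ t * (n.choose t : R) := by
  have h : (1 - X : R[X]) = (1 + X).comp (-X) := by simp [sub_eq_add_neg]
  rw [h, ← pow_comp]
  have h2 : (-X : R[X]) = C (-1) * X := by simp
  rw [h2, comp_C_mul_X_coeff, coeff_one_add_X_pow, mul_comm]

theorem coeff_prod_one_sub_C_mul_X {R ι : Type*} [CommRing R] (s : Finset ι) (f : ι → R) (t : ℕ) :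
    (∏ x ∈ s, (1 - C (f x) * X)).coeff t = (-1) ^ t * ∑ S ∈ s.powersetCard t, ∏ x ∈ S, f x := by
  classical
  have h : ∀ S : Finset ι, ∏ x ∈ S, (-(C (f x) * X)) = C ((-1) ^ S.card * ∏ x ∈ S, f x) * X ^ S.card := by
    intro S
    rw [Finset.prod_neg, Finset.prod_mul_distrib, Finset.prod_const, ← map_prod]
    simp [mul_assoc]
  simp_rw [sub_eq_add_neg, Finset.prod_one_add, finsetSum_coeff, h, coeff_C_mul_X_pow]
  rw [← Finset.sum_filter, Finset.mul_sum]
  have : {a ∈ s.powerset | t = a.card} = s.powersetCard t := by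
    ext a; simp [Finset.mem_powersetCard, eq_comm]
  rw [this]
  refine Finset.sum_congr rfl fun S hS => ?_
  rw [(Finset.mem_powersetCard.1 hS).2]

/-- Multiplication by `1 - X` takes differences of consecutive coefficients, so those of `E` are
partial sums of those of `(1 - X ^ p) ^ m`, which live at multiples of `p`. -/
theorem coeff_of_one_sub_X_mul_eq {R : Type*} [CommRing R] {p m : ℕ} (hp : 0 < p) {E : R[X]}
    (hE : (1 - X) * E = (1 - X ^ p) ^ m) (t : ℕ) :
    E.coeff t = ∑ j ∈ Finset.range (t / p + 1), (-1) ^ j * (m.choose j : R) := by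
  have hexp : (1 - X ^ p : R[X]) ^ m = expand R p ((1 - X) ^ m) := by simp
  have hc : ∀ i, ((1 - X) * E).coeff i
      = if p ∣ i then (-1) ^ (i / p) * (m.choose (i / p) : R) else 0 := by
    intro i
    rw [hE, hexp, coeff_expand hp]
    split_ifs
    · rw [coeff_one_sub_X_pow]
    · rfl
  induction t with
  | zero =>
    have := hc 0
    rw [sub_mul, one_mul, coeff_sub] at this
    simpa using this
  | succ t ih =>
    have := hc (t + 1)
    rw [sub_mul, one_mul, coeff_sub, coeff_X_mul, sub_eq_iff_eq_add] at this
    rw [this, ih, Nat.succ_div]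
    split_ifs
    · rw [Finset.sum_range_succ _ (t / p + 1), add_comm]
    · simp

/-- The values of `ψ` fill the group of `p`-th roots of unity, which has prime order, and all fibres
are cosets of the kernel. -/
theorem prod_one_sub_addChar {H : Type*} [AddCommGroup H] [Fintype H] {p : ℕ}
    (hp : p.Prime) (hH : ∀ x : H, p • x = 0) {ψ : AddChar H ℂ} (hψ : ψ ≠ 0) :
    ∏ x : H, (1 - C (ψ x) * X) = (1 - X ^ p) ^ (Fintype.card H / p) := by
  classical
  obtain ⟨h, hh⟩ : ∃ h, ψ h ≠ 1 := by
    by_contra! hcon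
    exact hψ (by ext x; simpa using hcon x)
  have hpow : ∀ x, ψ x ^ p = 1 := fun x => by rw [← AddChar.map_nsmul_eq_pow, hH, AddChar.map_zero_eq_one]
  have := Fact.mk hp
  have hprim : IsPrimitiveRoot (ψ h) p := by
    have := orderOf_eq_prime (hpow h) hh
    exact IsPrimitiveRoot.iff_orderOf.2 this
  have himg : Finset.univ.image ψ = nthRootsFinset p (1 : ℂ) := by
    ext z
    simp only [Finset.mem_image, Finset.mem_univ, true_and, mem_nthRootsFinset hp.pos]
    constructor
    · rintro ⟨x, rfl⟩; exact hpow x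
    · intro hz
      obtain ⟨i, -, hi⟩ := hprim.eq_pow_of_pow_eq_one hz
      exact ⟨i • h, by rw [AddChar.map_nsmul_eq_pow, hi]⟩
  have hcardimg : (Finset.univ.image ψ).card = p := by rw [himg, hprim.card_nthRootsFinset]
  have hfib : ∀ z ∈ Finset.univ.image ψ, (Finset.univ.filter fun x => ψ x = z).card = Fintype.card H / p := by
    have hconst : ∀ z ∈ Finset.univ.image ψ, (Finset.univ.filter fun x => ψ x = z).card
        = (Finset.univ.filter fun x => ψ x = 1).card := by
      intro z hz
      obtain ⟨a, -, rfl⟩ := Finset.mem_image.1 hz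
      refine Finset.card_bij' (fun x _ => x - a) (fun x _ => x + a) ?_ ?_ ?_ ?_
      · intro x hx
        simp only [Finset.mem_filter, Finset.mem_univ, true_and] at hx ⊢
        rw [AddChar.map_sub_eq_div, hx, div_self]
        intro h0
        have := hpow a
        rw [h0, zero_pow hp.ne_zero] at this
        exact zero_ne_one this
      · intro x hx
        simp only [Finset.mem_filter, Finset.mem_univ, true_and] at hx ⊢
        rw [AddChar.map_add_eq_mul, hx, one_mul]
      · simp
      · simp
    have hsum := Finset.card_eq_sum_card_image (f := ψ) (s := Finset.univ)
    rw [Finset.sum_congr rfl hconst, Finset.sum_const, hcardimg, Finset.card_univ, smul_eq_mul] at hsum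
    intro z hz
    rw [hconst z hz, hsum, Nat.mul_div_cancel_left _ hp.pos]
  rw [Finset.prod_comp (fun z : ℂ => (1 - C z * X : ℂ[X])) ψ, Finset.prod_congr rfl fun z hz => by rw [hfib z hz],
    Finset.prod_pow, himg]
  congr 1
  have hC := hprim.map_of_injective (f := (C : ℂ →+* ℂ[X])) C_injective
  have key := hC.pow_sub_pow_eq_prod_sub_mul 1 X hp.pos
  rw [one_pow] at key
  rw [key]
  symm
  have hinj : Set.InjOn (C : ℂ →+* ℂ[X]) (nthRootsFinset p (1 : ℂ)) := C_injective.injOn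
  rw [← Finset.prod_image (g := (C : ℂ →+* ℂ[X])) (f := fun z => 1 - z * X) hinj]
  congr 1
  refine (Finset.eq_of_subset_of_card_le ?_ ?_).symm
  · intro z hz
    obtain ⟨w, hw, rfl⟩ := Finset.mem_image.1 hz
    rw [mem_nthRootsFinset hp.pos] at hw ⊢
    rw [← map_pow, hw, map_one]
  · rw [Finset.card_image_of_injective _ C_injective, hC.card_nthRootsFinset, hprim.card_nthRootsFinset]

/-- Number of `t`-element sets of nonzero elements of an elementary abelian `p`-group with
prescribed sum. -/
theorem card_mul_card_subset_sum_eq {H : Type*} [AddCommGroup H] [Fintype H] [DecidableEq H] {p : ℕ}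
    (hp : p.Prime) (hH : ∀ x : H, p • x = 0) (t : ℕ) (b : H) :
    (Fintype.card H : ℚ) *
        (((Finset.univ.erase (0 : H)).powersetCard t).filter fun S => ∑ x ∈ S, x = b).card =
      ((Fintype.card H - 1).choose t : ℚ) + (if b = 0 then (Fintype.card H : ℚ) - 1 else -1) *
        ((-1) ^ t * ∑ j ∈ Finset.range (t / p + 1), (-1) ^ j * ((Fintype.card H / p).choose j : ℚ)) := by
  classical
  set U := Finset.univ.erase (0 : H)
  set c := Fintype.card H
  set T : ℂ := ∑ j ∈ Finset.range (t / p + 1), (-1) ^ j * ((c / p).choose j : ℂ)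
  have hUcard : U.card = c - 1 := by simp [U, c, Finset.card_erase_of_mem]
  have hsymm : ∀ ψ : AddChar H ℂ, ∑ S ∈ U.powersetCard t, ∏ x ∈ S, ψ x
      = if ψ = 0 then ((c - 1).choose t : ℂ) else (-1) ^ t * T := by
    intro ψ
    split_ifs with hψ
    · subst hψ
      simp [hUcard]
    · have hprod := prod_one_sub_addChar hp hH hψ
      rw [← Finset.mul_prod_erase _ _ (Finset.mem_univ (0 : H)), AddChar.map_zero_eq_one, C_1,
        one_mul] at hprod
      have hco := coeff_of_one_sub_X_mul_eq hp.pos hprod t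
      rw [coeff_prod_one_sub_C_mul_X] at hco
      rw [show T = _ from hco.symm, ← mul_assoc, ← mul_pow]
      simp [U]
  have hleft : ∑ ψ : AddChar H ℂ, ψ (-b) * ∑ S ∈ U.powersetCard t, ∏ x ∈ S, ψ x
      = (c : ℂ) * ((U.powersetCard t).filter fun S => ∑ x ∈ S, x = b).card := by
    simp_rw [Finset.mul_sum]
    rw [Finset.sum_comm]
    have : ∀ S : Finset H, ∑ ψ : AddChar H ℂ, ψ (-b) * ∏ x ∈ S, ψ x
        = if ∑ x ∈ S, x = b then (c : ℂ) else 0 := by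
      intro S
      have h1 : ∀ ψ : AddChar H ℂ, ψ (-b) * ∏ x ∈ S, ψ x = ψ (-b + ∑ x ∈ S, x) := by
        intro ψ
        rw [AddChar.map_add_eq_mul]
        congr 1
        exact (map_prod ψ.toMonoidHom (fun x => Multiplicative.ofAdd x) S).symm
      simp_rw [h1, AddChar.sum_apply_eq_ite]
      simp only [neg_add_eq_zero, eq_comm (a := b)]
      rfl
    rw [Finset.sum_congr rfl fun S _ => this S, ← Finset.sum_filter, Finset.sum_const, nsmul_eq_mul,
      mul_comm]
  have hright : ∑ ψ : AddChar H ℂ, ψ (-b) * ∑ S ∈ U.powersetCard t, ∏ x ∈ S, ψ x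
      = ((c - 1).choose t : ℂ) + (if b = 0 then (c : ℂ) - 1 else -1) * ((-1) ^ t * T) := by
    -- All nontrivial characters give the same value; extending it to `ψ = 0` with a correction
    -- leaves a full character sum.
    have h1 : ∀ ψ : AddChar H ℂ, ψ (-b) * ∑ S ∈ U.powersetCard t, ∏ x ∈ S, ψ x
        = ψ (-b) * ((-1) ^ t * T) + if ψ = 0 then (((c - 1).choose t : ℂ) - (-1) ^ t * T) else 0 := by
      intro ψ
      rw [hsymm]
      split_ifs with hψ
      · subst hψ; simp
      · simp
    rw [Finset.sum_congr rfl fun ψ _ => h1 ψ, Finset.sum_add_distrib, ← Finset.sum_mul,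
      AddChar.sum_apply_eq_ite, Finset.sum_ite_eq' Finset.univ (0 : AddChar H ℂ)]
    simp only [neg_eq_zero, Finset.mem_univ, if_true]
    split_ifs <;> ring
  have key := hleft.symm.trans hright
  have : (((c : ℚ) * ((U.powersetCard t).filter fun S => ∑ x ∈ S, x = b).card : ℚ) : ℂ)
      = ((((c - 1).choose t : ℚ) + (if b = 0 then (c : ℚ) - 1 else -1) *
        ((-1) ^ t * ∑ j ∈ Finset.range (t / p + 1), (-1) ^ j * ((c / p).choose j : ℚ)) : ℚ) : ℂ) := by
    push_cast
    rw [key]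
    split_ifs <;> simp [T]
  exact_mod_cast this

end SubsetSums

/-! ### Binomial inversion. -/

section Inversion

theorem sum_choose_mul_choose {K : Type*} [CommRing K] (M n r : ℕ) (f : ℕ → K) :
    ∑ s ∈ Finset.range M, (s.choose r : K) * (n.choose s : K) * f s =
      (n.choose r : K) * ∑ j ∈ Finset.range (M - r), ((n - r).choose j : K) * f (r + j) := by
  rcases le_total M r with h | h
  · rw [Nat.sub_eq_zero_of_le h]
    simp only [Finset.range_zero, Finset.sum_empty, mul_zero]
    refine Finset.sum_eq_zero fun s hs => ?_
    rw [Nat.choose_eq_zero_of_lt ((Finset.mem_range.1 hs).trans_le h)]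
    simp
  · obtain ⟨d, rfl⟩ := Nat.exists_eq_add_of_le h
    rw [Finset.sum_range_add, Nat.add_sub_cancel_left, Finset.mul_sum]
    have : ∑ s ∈ Finset.range r, (s.choose r : K) * (n.choose s : K) * f s = 0 := by
      refine Finset.sum_eq_zero fun s hs => ?_
      rw [Nat.choose_eq_zero_of_lt (Finset.mem_range.1 hs)]
      simp
    rw [this, zero_add]
    refine Finset.sum_congr rfl fun j _ => ?_
    have := Nat.choose_mul (n := n) (k := r + j) (s := r) (Nat.le_add_right _ _)
    rw [Nat.add_sub_cancel_left] at this
    have h2 : ((n.choose (r + j) : ℕ) : K) * ((r + j).choose r : ℕ)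
        = (n.choose r : ℕ) * ((n - r).choose j : ℕ) := by exact_mod_cast congrArg (Nat.cast (R := K)) this
    rw [mul_comm ((r + j).choose r : K), h2, mul_assoc]

/-- With `R` the number of roots of `g` in `D`, this is the indicator of exactly `r` roots. The
slack `R ≤ M` allows one summation range for all `g`. -/
theorem sum_neg_one_pow_choose_mul_choose {M R : ℕ} (h : R ≤ M) (r : ℕ) :
    ∑ s ∈ Finset.range (M + 1), (-1 : ℚ) ^ (s + r) * (s.choose r : ℚ) * (R.choose s : ℚ) =
      if R = r then 1 else 0 := by
  have h1 : ∑ s ∈ Finset.range (M + 1), (-1 : ℚ) ^ (s + r) * (s.choose r : ℚ) * (R.choose s : ℚ)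
      = ∑ s ∈ Finset.range (R + 1), (s.choose r : ℚ) * (R.choose s : ℚ) * (-1 : ℚ) ^ (s + r) := by
    symm
    rw [Finset.sum_subset (Finset.range_mono (Nat.succ_le_succ h))]
    · exact Finset.sum_congr rfl fun s _ => by ring
    · intro s _ hs
      rw [Nat.choose_eq_zero_of_lt (n := R) (by simpa using hs)]
      simp
  rw [h1, sum_choose_mul_choose]
  rcases lt_or_ge R r with hr | hr
  · rw [Nat.choose_eq_zero_of_lt hr, if_neg hr.ne]
    simp
  · have h2 : ∑ j ∈ Finset.range (R + 1 - r), ((R - r).choose j : ℚ) * (-1 : ℚ) ^ (r + j + r)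
        = ((∑ j ∈ Finset.range (R - r + 1), ((-1) ^ j * ((R - r).choose j : ℤ)) : ℤ) : ℚ) := by
      rw [Nat.succ_sub hr]
      push_cast
      refine Finset.sum_congr rfl fun j _ => ?_
      rw [show r + j + r = j + 2 * r by ring, pow_add, pow_mul]
      simp [mul_comm]
    rw [h2, Int.alternating_sum_range_choose]
    by_cases hRr : R = r
    · subst hRr; simp
    · have : R - r ≠ 0 := by omega
      simp [hRr, this]

end Inversion

/-! ### Monic polynomials with prescribed roots and second coefficient. -/

section MonicCounting

variable {F : Type*} [Field F]

/-- The monic polynomials of degree `m` with second leading coefficient `c`. -/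
def monicWithNextCoeff (m : ℕ) (c : F) : Set F[X] :=
  {g | g.Monic ∧ g.natDegree = m ∧ g.nextCoeff = c}

/-- `nextCoeff` of a constant is `0` by convention; this becomes the subset-sum condition when `S`
has `k + 1` elements. -/
theorem monicWithNextCoeff_zero [DecidableEq F] (c : F) :
    monicWithNextCoeff 0 c = if c = 0 then {1} else ∅ := by
  ext g
  have : g ∈ monicWithNextCoeff 0 c ↔ g = 1 ∧ c = 0 := by
    constructor
    · rintro ⟨h1, h2, h3⟩
      have : g = 1 := by rw [eq_C_of_natDegree_eq_zero h2, ← h2, coeff_natDegree, h1, C_1]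
      subst this
      exact ⟨rfl, by simpa [nextCoeff] using h3.symm⟩
    · rintro ⟨rfl, rfl⟩
      exact ⟨monic_one, natDegree_one, by simp [nextCoeff]⟩
  rw [this]
  split_ifs with h <;> simp [h]

theorem monicWithNextCoeff_succ (d : ℕ) (c : F) :
    monicWithNextCoeff (d + 1) c =
      (fun u : degreeLT F d => X ^ (d + 1) + (C c * X ^ d + (u : F[X]))) '' Set.univ := by
  ext g
  simp only [Set.image_univ, Set.mem_range]
  constructor
  · rintro ⟨h1, h2, h3⟩
    refine ⟨⟨g - X ^ (d + 1) - C c * X ^ d, ?_⟩, by simp⟩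
    rw [mem_degreeLT, degree_lt_iff_coeff_zero]
    intro i hi
    rw [nextCoeff_of_natDegree_pos (by omega), h2, Nat.add_sub_cancel] at h3
    have hl : g.coeff (d + 1) = 1 := by rw [← h2]; exact h1
    simp only [coeff_sub, coeff_X_pow, coeff_C_mul]
    rcases Nat.lt_or_ge (d + 1) i with h | h
    · rw [coeff_eq_zero_of_natDegree_lt (by omega), if_neg (by omega), if_neg (by omega)]
      simp
    · obtain rfl | rfl : i = d ∨ i = d + 1 := by omega
      · simp [h3]
      · simp [hl]
  · rintro ⟨⟨u, hu⟩, rfl⟩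
    rw [mem_degreeLT] at hu
    have hdeg : (C c * X ^ d + u).degree < ((d + 1 : ℕ) : WithBot ℕ) := by
      refine (degree_add_le _ _).trans_lt (max_lt ?_ ?_)
      · exact (degree_C_mul_X_pow_le d c).trans_lt (by exact_mod_cast Nat.lt_succ_self d)
      · exact hu.trans (by exact_mod_cast Nat.lt_succ_self d)
    have hnat : (X ^ (d + 1) + (C c * X ^ d + u)).natDegree = d + 1 := by
      apply natDegree_eq_of_degree_eq_some
      rw [degree_add_eq_left_of_degree_lt (by simpa using hdeg), degree_X_pow]
    refine ⟨monic_X_pow_add hdeg, hnat, ?_⟩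
    rw [nextCoeff_of_natDegree_pos (by rw [hnat]; exact d.succ_pos), hnat, Nat.add_sub_cancel]
    simp [coeff_X_pow, coeff_eq_zero_of_degree_lt hu]

theorem finite_monicWithNextCoeff [Finite F] (m : ℕ) (c : F) :
    (monicWithNextCoeff m c).Finite := by
  classical
  cases m with
  | zero => rw [monicWithNextCoeff_zero]; split_ifs <;> simp
  | succ d =>
    rw [monicWithNextCoeff_succ]
    have : Finite (degreeLT F d) := Finite.of_equiv _ (degreeLTEquiv F d).toEquiv.symm
    exact Set.toFinite _

theorem ncard_monicWithNextCoeff_succ [Fintype F] (d : ℕ) (c : F) :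
    (monicWithNextCoeff (d + 1) c).ncard = Fintype.card F ^ d := by
  rw [monicWithNextCoeff_succ, Set.ncard_image_of_injective, Set.ncard_univ,
    Nat.card_congr (degreeLTEquiv F d).toEquiv]
  · simp
  · intro u v huv
    simpa using huv

/-- `nextCoeff` is additive on products of monic polynomials, and that of `∏ a ∈ S, (X - C a)` is
`-∑ a ∈ S, a`. -/
theorem monicWithNextCoeff_and_forall_isRoot (S : Finset F) (m : ℕ) (c : F) :
    {g ∈ monicWithNextCoeff (S.card + m) c | ∀ a ∈ S, g.IsRoot a} =
      (fun h => (∏ a ∈ S, (X - C a)) * h) '' monicWithNextCoeff m (c + ∑ a ∈ S, a) := by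
  have hP : (∏ a ∈ S, (X - C a)).Monic := monic_prod_X_sub_C (fun a => a) S
  have hPd : (∏ a ∈ S, (X - C a)).natDegree = S.card := natDegree_finsetProd_X_sub_C_eq_card S (fun a => a)
  have hPn : (∏ a ∈ S, (X - C a)).nextCoeff = -∑ a ∈ S, a := prod_X_sub_C_nextCoeff (fun a => a)
  ext g
  constructor
  · rintro ⟨⟨h1, h2, h3⟩, h4⟩
    have hdvd : (∏ a ∈ S, (X - C a)) ∣ g := by
      refine Finset.prod_dvd_of_coprime (fun a _ b _ hab => ?_) fun a ha => dvd_iff_isRoot.2 (h4 a ha)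
      exact pairwise_coprime_X_sub_C Function.injective_id hab
    obtain ⟨h, rfl⟩ := hdvd
    have hm : h.Monic := hP.of_mul_monic_left h1
    refine ⟨h, ⟨hm, ?_, ?_⟩, rfl⟩
    · rw [hP.natDegree_mul hm, hPd] at h2; omega
    · rw [hP.nextCoeff_mul hm, hPn] at h3
      rw [← h3]; ring
  · rintro ⟨h, ⟨h1, h2, h3⟩, rfl⟩
    refine ⟨⟨hP.mul h1, ?_, ?_⟩, fun a ha => ?_⟩
    · rw [hP.natDegree_mul h1, hPd, h2]
    · rw [hP.nextCoeff_mul h1, hPn, h3]; ring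
    · refine dvd_iff_isRoot.1 (Dvd.dvd.mul_right (Finset.dvd_prod_of_mem _ ha) _)

theorem ncard_monicWithNextCoeff_and_forall_isRoot (S : Finset F) (m : ℕ) (c : F) :
    {g ∈ monicWithNextCoeff (S.card + m) c | ∀ a ∈ S, g.IsRoot a}.ncard =
      (monicWithNextCoeff m (c + ∑ a ∈ S, a)).ncard := by
  rw [monicWithNextCoeff_and_forall_isRoot, Set.ncard_image_of_injective]
  exact mul_right_injective₀ (monic_prod_X_sub_C (fun a => a) S).ne_zero

end MonicCounting

/-! ### Inclusion-exclusion and the final formulas. -/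

section Assembly

variable {F : Type*} [Field F]

theorem prescribedSet_one_eq [DecidableEq F] (D : Finset F) (k r : ℕ) (γ : F) :
    prescribedSet 1 D (X ^ (k + 1) + C γ * X ^ k) r =
      {g ∈ monicWithNextCoeff (k + 1) γ | (D.filter fun x => g.eval x = 0).card = r} := by
  have hdeg : (C γ * X ^ k : F[X]).degree < ((k + 1 : ℕ) : WithBot ℕ) :=
    (degree_C_mul_X_pow_le k γ).trans_lt (by exact_mod_cast Nat.lt_succ_self k)
  have hnat : (X ^ (k + 1) + C γ * X ^ k : F[X]).natDegree = k + 1 := by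
    apply natDegree_eq_of_degree_eq_some
    rw [degree_add_eq_left_of_degree_lt (by simpa using hdeg), degree_X_pow]
  have hlead : leadingCoeffAt (X ^ (k + 1) + C γ * X ^ k : F[X]) 1 = γ := by
    simp [leadingCoeffAt, hnat, coeff_X_pow]
  ext g
  have hroots : {x : F | x ∈ D ∧ g.IsRoot x}.ncard = (D.filter fun x => g.eval x = 0).card := by
    rw [← Set.ncard_coe_finset]
    congr 1
    ext x
    simp
  have hsame : g.natDegree = k + 1 →
      (SameLeading 1 (X ^ (k + 1) + C γ * X ^ k) g ↔ g.nextCoeff = γ) := by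
    intro hg
    have hg1 : leadingCoeffAt g 1 = g.nextCoeff := by
      rw [nextCoeff_of_natDegree_pos (by omega), leadingCoeffAt, if_pos (by omega)]
    constructor
    · intro h
      rw [← hg1, h 1 le_rfl le_rfl, hlead]
    · intro h i h1 h2
      obtain rfl := le_antisymm h2 h1
      rw [hg1, h, hlead]
  simp only [prescribedSet, Set.mem_ofPred_eq, monicWithNextCoeff, hnat, hroots]
  constructor
  · rintro ⟨h1, h2, h3, h4⟩
    exact ⟨⟨h1, h2, (hsame h2).1 h3⟩, h4⟩
  · rintro ⟨⟨h1, h2, h3⟩, h4⟩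
    exact ⟨h1, h2, (hsame h2).2 h3, h4⟩

theorem countN_one_eq_sum_powersetCard [Finite F] (D : Finset F) (k r : ℕ) (γ : F) :
    (countN 1 D (X ^ (k + 1) + C γ * X ^ k) r : ℚ) =
      ∑ s ∈ Finset.range (k + 2), (-1 : ℚ) ^ (s + r) * (s.choose r : ℚ) *
        ∑ S ∈ D.powersetCard s,
          ({g ∈ monicWithNextCoeff (k + 1) γ | ∀ a ∈ S, g.IsRoot a}.ncard : ℚ) := by
  classical
  have hfin := finite_monicWithNextCoeff (k + 1) γ
  set G := hfin.toFinset with hG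
  have hle : ∀ g ∈ G, (D.filter fun x => g.eval x = 0).card ≤ k + 1 := by
    intro g hg
    obtain ⟨h1, h2, -⟩ := hfin.mem_toFinset.1 hg
    rw [← h2]
    refine (Finset.card_le_card (t := g.roots.toFinset) fun x hx => ?_).trans
      ((Multiset.toFinset_card_le _).trans (card_roots' g))
    rw [Multiset.mem_toFinset, mem_roots h1.ne_zero]
    exact (Finset.mem_filter.1 hx).2
  -- Double counting of pairs `(g, S)` with `S` an `s`-set of roots of `g` in `D`.
  have hchoose : ∀ s, ∑ g ∈ G, (((D.filter fun x => g.eval x = 0).card.choose s : ℕ) : ℚ) =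
      ∑ S ∈ D.powersetCard s,
        ({g ∈ monicWithNextCoeff (k + 1) γ | ∀ a ∈ S, g.IsRoot a}.ncard : ℚ) := by
    intro s
    have h1 : ∀ g : F[X], (((D.filter fun x => g.eval x = 0).card.choose s : ℕ) : ℚ) =
        ∑ S ∈ D.powersetCard s, if ∀ a ∈ S, g.IsRoot a then 1 else 0 := by
      intro g
      rw [← Finset.card_powersetCard, ← Finset.sum_filter, Finset.sum_const, nsmul_eq_mul, mul_one]
      congr 2
      ext S
      simp only [Finset.mem_powersetCard, Finset.mem_filter, Finset.subset_iff, IsRoot.def]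
      grind
    simp_rw [h1]
    rw [Finset.sum_comm]
    refine Finset.sum_congr rfl fun S _ => ?_
    rw [← Finset.sum_filter, Finset.sum_const, nsmul_eq_mul, mul_one, ← Set.ncard_coe_finset]
    congr 2
    ext g
    simp [hG]
  have hcount : (countN 1 D (X ^ (k + 1) + C γ * X ^ k) r : ℚ) =
      ∑ g ∈ G, if (D.filter fun x => g.eval x = 0).card = r then (1 : ℚ) else 0 := by
    rw [countN, prescribedSet_one_eq, ← Finset.sum_filter, Finset.sum_const, nsmul_eq_mul, mul_one,
      ← Set.ncard_coe_finset]
    congr 2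
    ext g
    simp [hG]
  rw [hcount, Finset.sum_congr rfl fun g hg => (sum_neg_one_pow_choose_mul_choose (hle g hg) r).symm,
    Finset.sum_comm]
  refine Finset.sum_congr rfl fun s _ => ?_
  rw [← Finset.mul_sum, hchoose]

/-- The count for an arbitrary evaluation set, in terms of the number of `(k + 1)`-subsets of `D`
with sum `-γ`. -/
theorem countN_one_eq [Fintype F] [DecidableEq F] (D : Finset F) (k r : ℕ) (γ : F) :
    (countN 1 D (X ^ (k + 1) + C γ * X ^ k) r : ℚ) =
      (Fintype.card F : ℚ) ^ ((k : ℤ) - r) * (D.card.choose r : ℚ) *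
          ∑ j ∈ Finset.range (k + 1 - r),
            (-(Fintype.card F : ℚ)) ^ (-(j : ℤ)) * ((D.card - r).choose j : ℚ)
        + (-1) ^ (k + 1 + r) * ((k + 1).choose r : ℚ) *
          ((D.powersetCard (k + 1)).filter fun S => ∑ x ∈ S, x = -γ).card := by
  have hq : (Fintype.card F : ℚ) ≠ 0 := by exact_mod_cast Fintype.card_ne_zero
  -- The split-off top term `s = k + 1` is the only one depending on `γ`.
  rw [countN_one_eq_sum_powersetCard, Finset.sum_range_succ]
  congr 1
  · have h1 : ∀ s ∈ Finset.range (k + 1), (-1 : ℚ) ^ (s + r) * (s.choose r : ℚ) *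
        ∑ S ∈ D.powersetCard s,
          ({g ∈ monicWithNextCoeff (k + 1) γ | ∀ a ∈ S, g.IsRoot a}.ncard : ℚ) =
        (s.choose r : ℚ) * (D.card.choose s : ℚ) *
          ((-1 : ℚ) ^ (s + r) * (Fintype.card F : ℚ) ^ ((k : ℤ) - s)) := by
      intro s hs
      obtain ⟨d, rfl⟩ := Nat.exists_eq_add_of_le (Nat.lt_succ_iff.1 (Finset.mem_range.1 hs))
      have h2 : ∀ S ∈ D.powersetCard s,
          ({g ∈ monicWithNextCoeff (s + d + 1) γ | ∀ a ∈ S, g.IsRoot a}.ncard : ℚ) =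
            (Fintype.card F : ℚ) ^ d := by
        intro S hS
        rw [← (Finset.mem_powersetCard.1 hS).2, add_assoc,
          ncard_monicWithNextCoeff_and_forall_isRoot, ncard_monicWithNextCoeff_succ]
        push_cast
        rfl
      rw [Finset.sum_congr rfl h2, Finset.sum_const, Finset.card_powersetCard, nsmul_eq_mul]
      have h3 : (((s + d : ℕ) : ℤ) - s) = (d : ℤ) := by push_cast; ring
      rw [h3, zpow_natCast]
      ring
    rw [Finset.sum_congr rfl h1, sum_choose_mul_choose, mul_comm ((Fintype.card F : ℚ) ^ _),
      mul_assoc]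
    congr 1
    rw [Finset.mul_sum]
    refine Finset.sum_congr rfl fun j _ => ?_
    have h4 : (-(Fintype.card F : ℚ)) ^ (-(j : ℤ)) =
        (-1) ^ j * (Fintype.card F : ℚ) ^ (-(j : ℤ)) := by
      rw [neg_eq_neg_one_mul, mul_zpow, zpow_neg, zpow_natCast]
      congr 1
      rcases neg_one_pow_eq_or ℚ j with h | h <;> rw [h] <;> norm_num
    have h5 : (k : ℤ) - ((r + j : ℕ) : ℤ) = (k - r) + (-(j : ℤ)) := by push_cast; ring
    have h6 : (-1 : ℚ) ^ (r + j + r) = (-1) ^ j := by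
      rw [show r + j + r = j + 2 * r by ring, pow_add, pow_mul]
      simp
    rw [h4, h5, zpow_add₀ hq, h6]
    ring
  · congr 1
    have h2 : ∀ S ∈ D.powersetCard (k + 1),
        ({g ∈ monicWithNextCoeff (k + 1) γ | ∀ a ∈ S, g.IsRoot a}.ncard : ℚ) =
          if ∑ x ∈ S, x = -γ then 1 else 0 := by
      intro S hS
      have h3 := ncard_monicWithNextCoeff_and_forall_isRoot S 0 γ
      rw [(Finset.mem_powersetCard.1 hS).2, add_zero, monicWithNextCoeff_zero] at h3
      rw [h3]
      simp only [add_comm γ, add_eq_zero_iff_eq_neg]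
      split_ifs <;> simp
    rw [Finset.sum_congr rfl h2, ← Finset.sum_filter, Finset.sum_const, nsmul_eq_mul, mul_one]

theorem card_subset_sum_eq_zero_of_notMem [DecidableEq F] {D : Finset F} {G : AddSubgroup F}
    (hG : (G : Set F) = (D : Set F) ∪ {0}) {b : F} (hb : b ∉ G) (t : ℕ) :
    ((D.powersetCard t).filter fun S => ∑ x ∈ S, x = b).card = 0 := by
  rw [Finset.card_eq_zero, Finset.filter_eq_empty_iff]
  rintro S hS rfl
  refine hb (G.sum_mem fun x hx => ?_)
  rw [← SetLike.mem_coe, hG]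
  exact Or.inl ((Finset.mem_powersetCard.1 hS).1 hx)

theorem card_add_one_mul_card_subset_sum_eq [DecidableEq F] {p : ℕ} [CharP F p] (hp : p.Prime)
    {D : Finset F} (h0 : (0 : F) ∉ D) {G : AddSubgroup F}
    (hG : (G : Set F) = (D : Set F) ∪ {0}) {b : F} (hb : b ∈ G) (t : ℕ) :
    ((D.card : ℚ) + 1) * ((D.powersetCard t).filter fun S => ∑ x ∈ S, x = b).card =
      (D.card.choose t : ℚ) + (if b = 0 then (D.card : ℚ) else -1) *
        ((-1) ^ t * ∑ j ∈ Finset.range (t / p + 1),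
          (-1) ^ j * (((D.card + 1) / p).choose j : ℚ)) := by
  classical
  have hfin : (G : Set F).Finite := hG ▸ Set.toFinite _
  have : Finite G := hfin.to_subtype
  have := Fintype.ofFinite G
  set e : G ↪ F := ⟨fun x => (x : F), Subtype.val_injective⟩
  have hmap : D = (Finset.univ.erase (0 : G)).map e := by
    ext x
    have hx : x ∈ G ↔ x ∈ D ∨ x = 0 := by
      rw [← SetLike.mem_coe, hG]; simp [or_comm]
    simp only [Finset.mem_map, Finset.mem_erase, Finset.mem_univ, and_true]
    constructor
    · intro h
      refine ⟨⟨x, hx.2 (Or.inl h)⟩, fun h' => ?_, rfl⟩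
      have h2 : x = 0 := congrArg Subtype.val h'
      exact h0 (h2 ▸ h)
    · rintro ⟨⟨y, hy⟩, hne, rfl⟩
      exact (hx.1 hy).resolve_right fun h' => hne (Subtype.ext h')
  have hcard : Fintype.card G = D.card + 1 := by
    rw [hmap, Finset.card_map, Finset.card_erase_of_mem (Finset.mem_univ _), Finset.card_univ]
    have := Fintype.card_pos (α := G)
    omega
  have hexp : ∀ x : G, p • x = 0 := fun x => Subtype.ext (by simp)
  have key := card_mul_card_subset_sum_eq hp hexp t (⟨b, hb⟩ : G)
  have hcount : ((D.powersetCard t).filter fun S => ∑ x ∈ S, x = b).card =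
      (((Finset.univ.erase (0 : G)).powersetCard t).filter fun S => ∑ x ∈ S, x = ⟨b, hb⟩).card := by
    conv_lhs => rw [hmap]
    rw [Finset.powersetCard_map, Finset.filter_map, Finset.card_map]
    congr 1
    refine Finset.filter_congr fun S _ => ?_
    simp [e, Subtype.ext_iff, Finset.mapEmbedding_apply]
  rw [hcard] at key
  rw [hcount]
  have hb0 : (⟨b, hb⟩ : G) = 0 ↔ b = 0 := by simp [Subtype.ext_iff]
  simp only [hb0] at key
  simpa using key

/-- For `m < r` both sides vanish, the left one by the convention in `binom`. -/
theorem neg_one_zpow_mul_choose_mul_binom (n m r : ℕ) :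
    (-1 : ℚ) ^ ((m : ℤ) - r) * (n.choose r : ℚ) * binom (n - r) ((m : ℤ) - r) =
      (-1) ^ (m + r) * (m.choose r : ℚ) * (n.choose m : ℚ) := by
  rcases lt_or_ge m r with h | h
  · rw [binom, if_neg (by omega), Nat.choose_eq_zero_of_lt h]
    simp
  · obtain ⟨d, rfl⟩ := Nat.exists_eq_add_of_le h
    have h1 : ((r + d : ℕ) : ℤ) - r = (d : ℤ) := by push_cast; ring
    have h2 : (n.choose (r + d) : ℚ) * ((r + d).choose r : ℚ) =
        (n.choose r : ℚ) * ((n - r).choose d : ℚ) := by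
      have := Nat.choose_mul (n := n) (k := r + d) (s := r) (Nat.le_add_right _ _)
      rw [Nat.add_sub_cancel_left] at this
      exact_mod_cast this
    rw [h1, binom, if_pos (by omega), Int.toNat_natCast, zpow_natCast, mul_assoc, ← h2,
      show r + d + r = d + 2 * r by ring, pow_add, pow_mul]
    simp only [neg_one_sq, one_pow, mul_one]
    ring

/-- Here `ε` is the sum of the nontrivial characters at `γ`, so that (a) and (c) are handled
together. -/
theorem countN_one_eq_of_mem [Fintype F] {p : ℕ} [CharP F p] {D : Finset F} (h0 : (0 : F) ∉ D)
    {G : AddSubgroup F} (hG : (G : Set F) = (D : Set F) ∪ {0}) (k r : ℕ) {γ : F} (hγ : γ ∈ G)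
    {ε : ℚ} (hε : (γ = 0 → ε = D.card) ∧ (γ ≠ 0 → ε = -1)) :
    (countN 1 D (X ^ (k + 1) + C γ * X ^ k) r : ℚ) =
      (Fintype.card F : ℚ) ^ ((k : ℤ) - r) * (D.card.choose r : ℚ) *
          ∑ j ∈ Finset.range (k + 1 - r),
            (-(Fintype.card F : ℚ)) ^ (-(j : ℤ)) * ((D.card - r).choose j : ℚ)
        + 1 / ((D.card : ℚ) + 1) * (-1) ^ ((k : ℤ) + 1 - r) * (D.card.choose r : ℚ) *
            binom (D.card - r) ((k : ℤ) + 1 - r)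
        + ε / ((D.card : ℚ) + 1) * (-1) ^ r * ((k + 1).choose r : ℚ) *
            ∑ j ∈ Finset.range ((k + 1) / p + 1),
              (-1) ^ j * (((D.card + 1) / p).choose j : ℚ) := by
  classical
  have hp : p.Prime := CharP.char_is_prime F p
  have key := card_add_one_mul_card_subset_sum_eq hp h0 hG (G.neg_mem hγ) (k + 1)
  have hif : (if -γ = 0 then (D.card : ℚ) else -1) = ε := by
    split_ifs with h
    · exact (hε.1 (neg_eq_zero.1 h)).symm
    · exact (hε.2 fun h' => h (neg_eq_zero.2 h')).symm
  rw [hif] at key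
  have hn : (D.card : ℚ) + 1 ≠ 0 := by positivity
  have hb := neg_one_zpow_mul_choose_mul_binom D.card (k + 1) r
  push_cast at hb
  rw [countN_one_eq]
  conv_rhs => rw [add_assoc]
  congr 1
  rw [mul_assoc (1 / ((D.card : ℚ) + 1)), mul_assoc (1 / ((D.card : ℚ) + 1)), hb]
  rw [mul_comm, ← eq_div_iff hn] at key
  rw [key]
  have hsign : (-1 : ℚ) ^ (k + 1 + r) * (-1) ^ (k + 1) = (-1) ^ r := by
    rw [← pow_add, show k + 1 + r + (k + 1) = r + 2 * (k + 1) by ring, pow_add, pow_mul]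
    simp
  rw [← hsign]
  field_simp

end Assembly

theorem theorem3 {F : Type*} [Field F] [Fintype F] (p : ℕ) [CharP F p]
    (q n : ℕ) (hq : Fintype.card F = q)
    (D : Finset F) (hn : D.card = n) (h0 : (0 : F) ∉ D)
    (hD : ∃ G : AddSubgroup F, (G : Set F) = (D : Set F) ∪ {0})
    (k r : ℕ) (γ : F) :
    (γ ∈ D →
      (countN 1 D (X ^ (k + 1) + C γ * X ^ k) r : ℚ) =
        (q : ℚ) ^ ((k : ℤ) - r) * (n.choose r : ℚ) *
            ∑ j ∈ Finset.range (k + 1 - r), (-(q : ℚ)) ^ (-(j : ℤ)) * ((n - r).choose j : ℚ)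
          + 1 / ((n : ℚ) + 1) * (-1) ^ ((k : ℤ) + 1 - r) * (n.choose r : ℚ) *
              binom (n - r) ((k : ℤ) + 1 - r)
          - 1 / ((n : ℚ) + 1) * (-1) ^ r * ((k + 1).choose r : ℚ) *
              ∑ j ∈ Finset.range ((k + 1) / p + 1), (-1) ^ j * (((n + 1) / p).choose j : ℚ)) ∧
    (γ ∉ (D : Set F) ∪ {0} →
      (countN 1 D (X ^ (k + 1) + C γ * X ^ k) r : ℚ) =
        (q : ℚ) ^ ((k : ℤ) - r) * (n.choose r : ℚ) *
            ∑ j ∈ Finset.range (k + 1 - r), (-(q : ℚ)) ^ (-(j : ℤ)) * ((n - r).choose j : ℚ)) ∧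
    (γ = 0 →
      (countN 1 D (X ^ (k + 1) + C γ * X ^ k) r : ℚ) =
        (q : ℚ) ^ ((k : ℤ) - r) * (n.choose r : ℚ) *
            ∑ j ∈ Finset.range (k + 1 - r), (-(q : ℚ)) ^ (-(j : ℤ)) * ((n - r).choose j : ℚ)
          + 1 / ((n : ℚ) + 1) * (-1) ^ ((k : ℤ) + 1 - r) * (n.choose r : ℚ) *
              binom (n - r) ((k : ℤ) + 1 - r)
          + (n : ℚ) / ((n : ℚ) + 1) * (-1) ^ r * ((k + 1).choose r : ℚ) *
              ∑ j ∈ Finset.range ((k + 1) / p + 1), (-1) ^ j * (((n + 1) / p).choose j : ℚ)) := by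
  obtain ⟨G, hG⟩ := hD
  subst hq hn
  have hmem : ∀ x, x ∈ G ↔ x ∈ (D : Set F) ∪ {0} := fun x => by rw [← hG]; rfl
  refine ⟨fun hγ => ?_, fun hγ => ?_, fun hγ => ?_⟩
  · have hγ0 : γ ≠ 0 := fun h => h0 (h ▸ hγ)
    rw [countN_one_eq_of_mem (p := p) (ε := -1) h0 hG k r ((hmem γ).2 (Or.inl hγ))
      ⟨fun h => absurd h hγ0, fun _ => rfl⟩]
    ring
  · classical
    have hneg : -γ ∉ G := fun h => hγ ((hmem γ).1 (neg_mem_iff.1 h))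
    -- Sums of elements of `D` stay in `G`, so the correction term is zero.
    rw [countN_one_eq, card_subset_sum_eq_zero_of_notMem hG hneg]
    simp
  · rw [countN_one_eq_of_mem (p := p) (ε := D.card) h0 hG k r ((hmem γ).2 (Or.inr hγ))
      ⟨fun _ => rfl, fun h => absurd hγ h⟩]
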